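/- Let $q$ be a prime power and let $n,r$ be positive integers with $\gcd(q,nr)=1$. Let $\mathbb L$ be an extension field of $\mathbb F_q$ containing primitive $n$-th and $r$-th roots of unity, and let $U_n,U_r\subseteq\mathbb L$ denote the sets of all primitive $n$-th, respectively $r$-th, roots of unity. A cyclic code of length $r$ is an ideal $C$ of $\mathbb F_q(r)=\mathbb F_q[Y]/(Y^r-1)$, and a (bivariate) abelian code is an ideal of $\mathbb F_q(n,r)=\mathbb F_q[X,Y]/(X^n-1,Y^r-1)$; codewords are identified with their canonical polynomial representatives, $d(\cdot)$ is the minimum Hamming distance, and indices are taken in $\mathbb Z_r$, $\mathbb Z_n$. For $\beta\in U_r$ put $\mathcal D_\beta(C)=\{b\in\mathbb Z_r : c(\beta^b)=0\ \forall c\in C\}$, and for $\hat\alpha=(\alpha_1,\alpha_2)\in U_n\times U_r$ and an abelian code $E$ put $\mathcal D_{\hat\alpha}(E)=\{(a,b)\in\mathbb Z_n\times\mathbb Z_r : c(\alpha_1^a,\alpha_2^b)=0\ \forall c\in E\}$. Strong apparent distance. Set $sd^*(0)=0$ for the zero vector and the zero matrix. For a nonzero vector $v=(v_j)_{j\in\mathbb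 Z_r}$ let $\omega_v(b)$ be the least $l\ge 0$ with $v_{b+l}\ne 0$, and $sd^*(v)=\max_{b\in\mathbb Z_r}(\omega_v(b)+1)$. For a nonzero $\mathbb Z_n\times\mathbb Z_r$-matrix $M$ let $\epsilon_M(1)$ (resp. $\epsilon_M(2)$) be the maximum of $sd^*$ over the rows (resp. columns) of $M$, let $\omega_M(1)$ (resp. $\omega_M(2)$) be the maximum number of cyclically consecutive zero rows (resp. columns) of $M$, and $sd^*(M)=\max_{k=1,2}\epsilon_M(k)(\omega_M(k)+1)$. For a nonzero cyclic code $C$ and $\beta\in U_r$ let $sd^*_\beta(C)$ be the minimum of $sd^*\big((e(\beta^b))_{b\in\mathbb Z_r}\big)$ over the nonzero idempotents $e\in C$; let $sd^*(C)=\max_{\beta\in U_r}sd^*_\beta(C)$ and $\mathcal R(C)=\{\beta\in U_r : sd^*_\beta(C)=sd^*(C)\}$. For a nonzero abelian code $E$ let $sd^*(E)$ be the maximum over $\hat\alpha=(\alpha_1,\alpha_2)\in U_n\times U_r$ of the minimum of $sd^*\big((e(\alpha_1^a,\alpha_2^b))_{(a,b)}\big)$ over the nonzero idempotents $e\in E$.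 Proposition. If $C\subseteq\mathbb F_q(r)$ is a nonzero cyclic code with $sd^*(C)=d(C)$, then there exists $\hat\alpha=(\alpha_1,\alpha_2)\in U_n\times\mathcal R(C)$ such that there is exactly one abelian code $C_n$ in $\mathbb F_q(n,r)$ with defining set $\mathcal D_{\hat\alpha}(C_n)=\mathbb Z_n\times\mathcal D_{\alpha_2}(C)$, and this code satisfies $d(C_n)=d(C)$ and $sd^*(C_n)=d(C_n)$. -/

import Mathlib

/-! Cyclic codes of length `r` are ideals of the group algebra `F[ZMod r] ≅ F[Y]/(Y^r - 1)`,
and bivariate abelian codes are ideals of `F[ZMod n × ZMod r] ≅ F[X,Y]/(X^n - 1, Y^r - 1)`.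
The coefficient of the word `f` at `j` (at `(i, j)`) is the coefficient of `Y^j` (of `X^i Y^j`),
where elements of `ZMod r` are written through their canonical representatives `ZMod.val`. -/

noncomputable section

namespace AbelianCode

/-- The ambient algebra `F(r) = F[Y]/(Y^r - 1)` of cyclic codes of length `r`. -/
abbrev CyclicAmbient (F : Type*) [Field F] (r : ℕ) : Type _ :=
  AddMonoidAlgebra F (ZMod r)

/-- The ambient algebra `F(n, r) = F[X,Y]/(X^n - 1, Y^r - 1)` of bivariate abelian codes. -/
abbrev BivariateAmbient (F : Type*) [Field F] (n r : ℕ) : Type _ :=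
  AddMonoidAlgebra F (ZMod n × ZMod r)

open Classical in
/-- The minimum (Hamming) distance between two distinct codewords of a code. -/
def minDist {F G : Type*} [Field F] [AddCommMonoid G] [Fintype G]
    (C : Ideal (AddMonoidAlgebra F G)) : ℕ :=
  sInf {d : ℕ | ∃ f ∈ C, ∃ g ∈ C, f ≠ g ∧ d = hammingDist (⇑f.coeff) (⇑g.coeff)}

section Apparent

/-- For a nonzero family `v` indexed by `ZMod r`, the number of consecutive (cyclically) zero
entries `v b, v (b+1), …` preceding the first nonzero entry. It is `0` if `v b ≠ 0`.
Applied to a matrix, seen as the family of its rows, it counts consecutive zero rows. -/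
def zeroRun {A : Type*} [Zero A] {r : ℕ} (v : ZMod r → A) (b : ZMod r) : ℕ :=
  sInf {l : ℕ | v (b + (l : ZMod r)) ≠ 0}

open Classical in
/-- The strong apparent distance of a vector. -/
def vecSD {A : Type*} [Zero A] {r : ℕ} [NeZero r] (v : ZMod r → A) : ℕ :=
  if v = 0 then 0 else Finset.univ.sup fun b : ZMod r => zeroRun v b + 1

/-- The strong apparent distance of a matrix with respect to its first variable:
the maximum of the strong apparent distances of its rows, times one plus the maximum length of a
list of consecutive zero rows. -/
def matSDRows {A : Type*} [Zero A] {n r : ℕ} [NeZero n] [NeZero r]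
    (M : Matrix (ZMod n) (ZMod r) A) : ℕ :=
  (Finset.univ.sup fun b : ZMod n => vecSD (M.row b)) *
    ((Finset.univ.sup fun b : ZMod n => zeroRun M.row b) + 1)

open Classical in
/-- The strong apparent distance of a matrix: the maximum of the values with respect to the
first variable (rows) and the second variable (columns). -/
def matSD {A : Type*} [Zero A] {n r : ℕ} [NeZero n] [NeZero r]
    (M : Matrix (ZMod n) (ZMod r) A) : ℕ :=
  if M = 0 then 0 else max (matSDRows M) (matSDRows M.transpose)

end Apparent

section Cyclic

variable {F L : Type*} [Field F] [Field L] [Algebra F L] {r : ℕ} [NeZero r]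

/-- The value `f(y)` of a word `f`, seen as a polynomial of degree less than `r`. -/
def eval₁ (f : CyclicAmbient F r) (y : L) : L :=
  ∑ j : ZMod r, algebraMap F L (f.coeff j) * y ^ j.val

/-- The defining set of a cyclic code with respect to the root of unity `β`. -/
def definingSet₁ (β : L) (C : Ideal (CyclicAmbient F r)) : Set (ZMod r) :=
  {b | ∀ c ∈ C, eval₁ c (β ^ b.val) = 0}

/-- The coefficient vector of the discrete Fourier transform of `f` with respect to `β`. -/
def dft₁ (β : L) (f : CyclicAmbient F r) : ZMod r → L :=
  fun b => eval₁ f (β ^ b.val)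

/-- The strong apparent distance of a cyclic code with respect to `β`: the minimum over the
nonzero idempotents of the code. -/
def sdAt₁ (β : L) (C : Ideal (CyclicAmbient F r)) : ℕ :=
  sInf {d : ℕ | ∃ e ∈ C, e ≠ 0 ∧ e ^ 2 = e ∧ d = vecSD (dft₁ β e)}

variable (L) in
/-- The strong apparent distance of a cyclic code: the maximum over the primitive `r`-th roots
of unity in `L`. -/
def sd₁ (C : Ideal (CyclicAmbient F r)) : ℕ :=
  (primitiveRoots r L).sup fun β => sdAt₁ β C

variable (L) in
/-- The set of optimized roots of a cyclic code. -/
def optimizedRoots (C : Ideal (CyclicAmbient F r)) : Set L :=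
  {β | β ∈ primitiveRoots r L ∧ sd₁ L C = sdAt₁ β C}

end Cyclic

section Bivariate

variable {F L : Type*} [Field F] [Field L] [Algebra F L] {n r : ℕ} [NeZero n] [NeZero r]

/-- The value `f(x, y)` of a word `f`, seen as a polynomial in two variables. -/
def eval₂ (f : BivariateAmbient F n r) (x y : L) : L :=
  ∑ i : ZMod n, ∑ j : ZMod r, algebraMap F L (f.coeff (i, j)) * (x ^ i.val * y ^ j.val)

/-- The defining set of a bivariate abelian code with respect to `(α, β)`. -/
def definingSet₂ (α β : L) (C : Ideal (BivariateAmbient F n r)) : Set (ZMod n × ZMod r) :=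
  {p | ∀ c ∈ C, eval₂ c (α ^ p.1.val) (β ^ p.2.val) = 0}

/-- The coefficient matrix of the discrete Fourier transform of `f` with respect to `(α, β)`. -/
def dft₂ (α β : L) (f : BivariateAmbient F n r) : Matrix (ZMod n) (ZMod r) L :=
  Matrix.of fun a b => eval₂ f (α ^ a.val) (β ^ b.val)

/-- The strong apparent distance of a bivariate code with respect to `(α, β)`: the minimum over
the nonzero idempotents of the code. -/
def sdAt₂ (α β : L) (C : Ideal (BivariateAmbient F n r)) : ℕ :=
  sInf {d : ℕ | ∃ e ∈ C, e ≠ 0 ∧ e ^ 2 = e ∧ d = matSD (dft₂ α β e)}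

variable (L) in
/-- The strong apparent distance of a bivariate code: the maximum over all pairs of a primitive
`n`-th and a primitive `r`-th root of unity in `L`. -/
def sd₂ (C : Ideal (BivariateAmbient F n r)) : ℕ :=
  (primitiveRoots n L ×ˢ primitiveRoots r L).sup fun p => sdAt₂ p.1 p.2 C

end Bivariate

end AbelianCode

end

/-!
The code `C_n` consists of the bivariate words all of whose rows lie in `C`, so it has the same
minimum distance as `C`. Two facts make its strong apparent distance equal to it.

*Ideals and zeros.* Over a finite field with `n` and `r` invertible, evaluations at roots of unity
separate the words of the ambient algebra. In a finite ring every element has an idempotent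
power, and combining such powers gives, in any ideal, an idempotent whose Fourier transform
vanishes exactly on the defining set (`exists_idempotent_map_eq_zero_iff`). Hence an ideal is
determined by its defining set (`mem_ideal_iff_forall_map_eq_zero`), and the rows of the words of
`C_n` can be read off from the shape `ZMod n × D` of its defining set (`mem_iff_rowWord_mem`).

*The two inequalities.* The multivariate BCH bound (`matSD_le_card`) says that the strong apparent
distance of the transform of a word is at most its weight; applied to an idempotent power of a word
of minimum weight, it bounds the strong apparent distance of any code by its minimum distance
(`sdAt₂_le_minDist`). In the other direction, each row of the transform of a word of `C_n` vanishes
on the defining set `D` of `C`, that is, wherever the transform of the generating idempotent of `C`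
does. More zeros mean a larger apparent distance, so the apparent distance of `C_n` with respect to
`(α, β)` is at least that of `C` with respect to `β` (`sdAt₁_le_sdAt₂`). If `β` is an optimized root
of `C` and the strong apparent distance of `C` equals its minimum distance, the bounds meet.
-/

namespace AbelianCode

/-! ### Idempotents of finite commutative rings -/

theorem exists_pow_isIdempotentElem {M : Type*} [Monoid M] [Finite M] (x : M) :
    ∃ k : ℕ, k ≠ 0 ∧ IsIdempotentElem (x ^ k) := by
  obtain ⟨a, b, hab, h⟩ : ∃ a b : ℕ, a < b ∧ x ^ a = x ^ b := by
    obtain ⟨a, b, hne, h⟩ := Finite.exists_ne_map_eq_of_infinite (fun k : ℕ => x ^ k)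
    rcases lt_or_gt_of_ne hne with hlt | hlt
    · exact ⟨a, b, hlt, h⟩
    · exact ⟨b, a, hlt, h.symm⟩
  obtain ⟨p, rfl⟩ := Nat.exists_eq_add_of_lt hab
  set m := p + 1 with hm
  have hper : ∀ c, x ^ (a + c + m) = x ^ (a + c) := fun c => by
    rw [show a + c + m = (a + p + 1) + c by omega, pow_add, ← h, ← pow_add]
  have hper' : ∀ t c, x ^ (a + c + t * m) = x ^ (a + c) := fun t c => by
    induction t with
    | zero => simp
    | succ t ih =>
      rw [show a + c + (t + 1) * m = a + (c + t * m) + m by ring, hper, ← ih, add_assoc]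
  obtain ⟨c, hc⟩ : ∃ c, (a + 1) * m = a + c := Nat.exists_eq_add_of_le (by nlinarith)
  refine ⟨(a + 1) * m, by positivity, ?_⟩
  have := hper' (a + 1) c
  rwa [← hc, pow_add] at this

/-- Every ideal `I` of a finite commutative ring with enough homomorphisms to a field contains an
idempotent which is killed only by the homomorphisms killing `I`. -/
theorem exists_idempotent_map_eq_zero_iff {A L ι : Type*} [CommRing A] [Finite A] [Field L]
    (χ : ι → A →+* L) (hχ : ∀ f : A, (∀ i, χ i f = 0) → f = 0) (I : Ideal A) :
    ∃ e ∈ I, e ^ 2 = e ∧ ∀ i, χ i e = 0 ↔ ∀ c ∈ I, χ i c = 0 := by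
  classical
  cases nonempty_fintype A
  choose k hk0 hk using fun x : A => exists_pow_isIdempotentElem x
  set P : A := ∏ c ∈ Finset.univ.filter (· ∈ I), (1 - c ^ k c) with hP
  have hmem : 1 - P ∈ I := by
    rw [← Ideal.Quotient.eq_zero_iff_mem, map_sub, map_one, hP, map_prod, sub_eq_zero]
    refine (Finset.prod_eq_one fun c hc => ?_).symm
    rw [map_sub, map_one, Ideal.Quotient.eq_zero_iff_mem.2
      (I.pow_mem_of_mem (Finset.mem_filter.1 hc).2 _ (Nat.pos_of_ne_zero (hk0 c))), sub_zero]
  -- `χ i` sends the factor of `P` attached to `c` to `1` if `χ i c = 0`, and to `0` otherwise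
  have hval : ∀ i, (χ i P = 1 ∧ ∀ c ∈ I, χ i c = 0) ∨ (χ i P = 0 ∧ ∃ c ∈ I, χ i c ≠ 0) := by
    intro i
    by_cases h : ∀ c ∈ I, χ i c = 0
    · refine Or.inl ⟨?_, h⟩
      rw [hP, map_prod]
      refine Finset.prod_eq_one fun c hc => ?_
      rw [map_sub, map_one, map_pow, h c (Finset.mem_filter.1 hc).2, zero_pow (hk0 c), sub_zero]
    · push Not at h
      refine Or.inr ⟨?_, h⟩
      obtain ⟨c, hc, hne⟩ := h
      rw [hP, map_prod]
      refine Finset.prod_eq_zero (i := c) (by simp [hc]) ?_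
      have h1 : χ i (c ^ k c) * χ i (c ^ k c) = χ i (c ^ k c) := by rw [← map_mul, hk c]
      have h2 : χ i (c ^ k c) ≠ 0 := by rw [map_pow]; exact pow_ne_zero _ hne
      rw [map_sub, map_one, mul_left_cancel₀ h2 (h1.trans (mul_one _).symm), sub_self]
  refine ⟨1 - P, hmem, ?_, fun i => ?_⟩
  · refine sub_eq_zero.1 (hχ _ fun i => ?_)
    rcases hval i with ⟨h, -⟩ | ⟨h, -⟩ <;> simp [h]
  · rcases hval i with ⟨h, h'⟩ | ⟨h, c, hc, hne⟩
    · simpa [h] using h'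
    · simp only [map_sub, map_one, h, sub_zero, one_ne_zero, false_iff]
      exact fun h' => hne (h' c hc)

/-- An ideal of a finite commutative ring is determined by the homomorphisms killing it, if the
homomorphisms separate the elements of the ring. -/
theorem mem_ideal_iff_forall_map_eq_zero {A L ι : Type*} [CommRing A] [Finite A] [Field L]
    (χ : ι → A →+* L) (hχ : ∀ f : A, (∀ i, χ i f = 0) → f = 0) (I : Ideal A) (f : A) :
    f ∈ I ↔ ∀ i, (∀ c ∈ I, χ i c = 0) → χ i f = 0 := by
  refine ⟨fun hf i hi => hi f hf, fun h => ?_⟩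
  obtain ⟨e, he, hee, hei⟩ := exists_idempotent_map_eq_zero_iff χ hχ I
  have : f = f * e := by
    refine sub_eq_zero.1 (hχ _ fun i => ?_)
    have hid : χ i e * χ i e = χ i e := by rw [← map_mul, ← sq, hee]
    by_cases h0 : χ i e = 0
    · simp [h0, h i ((hei i).1 h0)]
    · simp [mul_left_cancel₀ h0 (hid.trans (mul_one _).symm)]
  rw [this]
  exact I.mul_mem_left _ he

/-! ### The strong apparent distance depends only on zero patterns -/

section Apparent

variable {A B : Type*} [Zero A] [Zero B] {n r : ℕ} [NeZero n] [NeZero r]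

theorem exists_natCast_add_ne_zero {v : ZMod r → A} (hv : v ≠ 0) (b : ZMod r) :
    ∃ l : ℕ, v (b + (l : ZMod r)) ≠ 0 := by
  obtain ⟨i, hi⟩ := Function.ne_iff.1 hv
  exact ⟨(i - b).val, by simpa using hi⟩

theorem zeroRun_le_zeroRun {v : ZMod r → A} {w : ZMod r → B} (hw : w ≠ 0)
    (h : ∀ i, v i = 0 → w i = 0) (b : ZMod r) : zeroRun v b ≤ zeroRun w b :=
  Nat.sInf_le fun h0 => Nat.sInf_mem (exists_natCast_add_ne_zero hw b) (h _ h0)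

theorem vecSD_le_vecSD {v : ZMod r → A} {w : ZMod r → B} (hw : w ≠ 0)
    (h : ∀ i, v i = 0 → w i = 0) : vecSD v ≤ vecSD w := by
  rw [vecSD, vecSD, if_neg hw]
  split_ifs
  · exact Nat.zero_le _
  · exact Finset.sup_mono_fun fun b _ => Nat.succ_le_succ (zeroRun_le_zeroRun hw h b)

theorem zeroRun_congr {k : ℕ} {v : ZMod k → A} {w : ZMod k → B} (h : ∀ i, v i = 0 ↔ w i = 0)
    (b : ZMod k) : zeroRun v b = zeroRun w b := by
  simp only [zeroRun, ne_eq, h]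

theorem vecSD_congr {v : ZMod r → A} {w : ZMod r → B} (h : ∀ i, v i = 0 ↔ w i = 0) :
    vecSD v = vecSD w := by
  have h0 : v = 0 ↔ w = 0 := by simp [funext_iff, h]
  simp only [vecSD, zeroRun_congr h]
  split_ifs <;> first | rfl | tauto

theorem matSDRows_congr {M : Matrix (ZMod n) (ZMod r) A} {N : Matrix (ZMod n) (ZMod r) B}
    (h : ∀ a b, M a b = 0 ↔ N a b = 0) : matSDRows M = matSDRows N := by
  have h1 : ∀ a, vecSD (M.row a) = vecSD (N.row a) := fun a => vecSD_congr (h a)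
  have h2 : ∀ a, zeroRun M.row a = zeroRun N.row a :=
    zeroRun_congr fun a => by simp [funext_iff, h]
  simp only [matSDRows, h1, h2]

theorem vecSD_row_le_matSD (M : Matrix (ZMod n) (ZMod r) A) (a : ZMod n) :
    vecSD (M.row a) ≤ matSD M := by
  by_cases hM : M = 0
  · have : M.row a = 0 := by rw [hM]; rfl
    simp [vecSD, this]
  rw [matSD, if_neg hM]
  refine le_trans ?_ (le_max_left _ _)
  exact (Finset.le_sup (f := fun a => vecSD (M.row a)) (Finset.mem_univ a)).trans
    (Nat.le_mul_of_pos_right _ (Nat.succ_pos _))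

end Apparent

/-! ### Discrete Fourier transforms and the apparent distance bound -/

section Fourier

variable {L : Type*} [Field L] {n r : ℕ} [NeZero n] [NeZero r]

/-- The discrete Fourier transform with respect to `β` of a vector with entries in `L`. -/
noncomputable def vecDFT (β : L) (v : ZMod r → L) (b : ZMod r) : L :=
  ∑ j, v j * (β ^ b.val) ^ j.val

/-- The discrete Fourier transform with respect to `(α, β)` of a matrix with entries in `L`. -/
noncomputable def matDFT (α β : L) (g : Matrix (ZMod n) (ZMod r) L) : Matrix (ZMod n) (ZMod r) L :=
  Matrix.of fun a b => ∑ i, ∑ j, g i j * ((α ^ a.val) ^ i.val * (β ^ b.val) ^ j.val)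

theorem matDFT_apply (α β : L) (g : Matrix (ZMod n) (ZMod r) L) (a : ZMod n) (b : ZMod r) :
    matDFT α β g a b = vecDFT β (fun j => vecDFT α (fun i => g i j) a) b := by
  simp only [matDFT, vecDFT, Matrix.of_apply, Finset.sum_mul]
  rw [Finset.sum_comm]
  simp only [mul_assoc]

theorem matDFT_transpose (α β : L) (g : Matrix (ZMod n) (ZMod r) L) :
    (matDFT α β g).transpose = matDFT β α g.transpose := by
  ext b a
  simp only [matDFT, Matrix.transpose_apply, Matrix.of_apply]
  rw [Finset.sum_comm]
  simp only [mul_comm]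

theorem pow_val_add_natCast {β : L} (hβ : β ^ r = 1) (b : ZMod r) (l : ℕ) :
    β ^ (b + (l : ZMod r)).val = β ^ b.val * β ^ l := by
  rw [ZMod.val_add, ZMod.val_natCast, Nat.add_mod_mod, ← pow_eq_pow_mod _ hβ, pow_add]

/-- The BCH bound: a vector supported on `S` is zero if its Fourier transform has `S.card`
consecutive zeros. -/
theorem eq_zero_of_vecDFT_eq_zero {β : L} (hβ : IsPrimitiveRoot β r) {v : ZMod r → L}
    {S : Finset (ZMod r)} (hS : ∀ j ∉ S, v j = 0) (b : ZMod r)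
    (h : ∀ l < S.card, vecDFT β v (b + (l : ZMod r)) = 0) : v = 0 := by
  classical
  -- the transform, near `b`, gives the power sums of the nodes `β ^ j` with weights `w j`
  set w : ZMod r → L := fun j => v j * (β ^ b.val) ^ j.val with hw
  have hpow : ∀ l < S.card, ∑ j ∈ S, w j * (β ^ j.val) ^ l = 0 := by
    intro l hl
    rw [← h l hl, vecDFT, ← Finset.sum_subset (Finset.subset_univ S)
      fun j _ hj => by rw [hS j hj, zero_mul]]
    refine Finset.sum_congr rfl fun j _ => ?_
    rw [pow_val_add_natCast hβ.pow_eq_one, mul_pow, hw, mul_assoc, ← pow_mul, ← pow_mul,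
      ← pow_mul, mul_comm l]
  have hpoly : ∀ p : Polynomial L, p.natDegree < S.card →
      ∑ j ∈ S, w j * p.eval (β ^ j.val) = 0 := by
    intro p hp
    simp only [Polynomial.eval_eq_sum_range' hp, Finset.mul_sum]
    rw [Finset.sum_comm]
    refine Finset.sum_eq_zero fun l hl => ?_
    simp only [mul_left_comm (w _)]
    rw [← Finset.mul_sum, hpow l (Finset.mem_range.1 hl), mul_zero]
  funext j₀
  by_cases hj₀ : j₀ ∈ S
  swap
  · exact hS j₀ hj₀
  set p : Polynomial L := ∏ j ∈ S.erase j₀, (Polynomial.X - Polynomial.C (β ^ j.val)) with hp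
  have hdeg : p.natDegree < S.card := by
    rw [hp, Polynomial.natDegree_finsetProd_X_sub_C_eq_card]
    exact Finset.card_erase_lt_of_mem hj₀
  have hsum := hpoly p hdeg
  rw [Finset.sum_eq_single_of_mem j₀ hj₀ fun j hj hne => by
    rw [hp, Polynomial.eval_prod, Finset.prod_eq_zero (Finset.mem_erase.2 ⟨hne, hj⟩) (by simp),
      mul_zero]] at hsum
  have hpe : p.eval (β ^ j₀.val) ≠ 0 := by
    rw [hp, Polynomial.eval_prod, Finset.prod_ne_zero_iff]
    intro j hj h0
    rw [Polynomial.eval_sub, Polynomial.eval_X, Polynomial.eval_C, sub_eq_zero] at h0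
    exact (Finset.mem_erase.1 hj).1 (ZMod.val_injective r
      (hβ.pow_inj (ZMod.val_lt j) (ZMod.val_lt j₀) h0.symm))
  have hβ0 : β ≠ 0 := hβ.ne_zero (NeZero.ne r)
  have hw0 := (mul_eq_zero.1 hsum).resolve_right hpe
  exact (mul_eq_zero.1 hw0).resolve_right (pow_ne_zero _ (pow_ne_zero _ hβ0))

theorem vecDFT_zero (β : L) : vecDFT β (0 : ZMod r → L) = 0 := by
  funext b
  simp [vecDFT]

theorem vecDFT_eq_zero_iff {β : L} (hβ : IsPrimitiveRoot β r) {v : ZMod r → L} :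
    vecDFT β v = 0 ↔ v = 0 := by
  refine ⟨fun h => ?_, fun h => by rw [h, vecDFT_zero]⟩
  exact eq_zero_of_vecDFT_eq_zero hβ (S := Finset.univ) (fun j hj => absurd (Finset.mem_univ j) hj)
    0 fun l _ => by rw [h]; rfl

theorem matDFT_eq_zero_iff {α β : L} (hα : IsPrimitiveRoot α n) (hβ : IsPrimitiveRoot β r)
    {g : Matrix (ZMod n) (ZMod r) L} : matDFT α β g = 0 ↔ g = 0 := by
  refine ⟨fun h => ?_, fun h => by ext; simp [matDFT, h]⟩
  have h1 : ∀ a, (fun j => vecDFT α (fun i => g i j) a) = 0 := fun a =>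
    (vecDFT_eq_zero_iff hβ).1 (funext fun b => by rw [← matDFT_apply, h]; rfl)
  have h2 : ∀ j, (fun i => g i j) = 0 := fun j =>
    (vecDFT_eq_zero_iff hα).1 (funext fun a => congrFun (h1 a) j)
  ext i j
  exact congrFun (h2 j) i

theorem zeroRun_vecDFT_lt_card {β : L} (hβ : IsPrimitiveRoot β r) {v : ZMod r → L} (hv : v ≠ 0)
    {S : Finset (ZMod r)} (hS : ∀ j ∉ S, v j = 0) (b : ZMod r) :
    zeroRun (vecDFT β v) b < S.card := by
  by_contra! hle
  refine hv (eq_zero_of_vecDFT_eq_zero hβ hS b fun l hl => ?_)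
  by_contra h0
  exact Nat.notMem_of_lt_sInf (hl.trans_le hle) h0

theorem vecSD_vecDFT_le_card {β : L} (hβ : IsPrimitiveRoot β r) {v : ZMod r → L}
    {S : Finset (ZMod r)} (hS : ∀ j ∉ S, v j = 0) : vecSD (vecDFT β v) ≤ S.card := by
  rw [vecSD]
  split_ifs with h0
  · exact Nat.zero_le _
  · exact Finset.sup_le fun b _ =>
      zeroRun_vecDFT_lt_card hβ (mt (vecDFT_eq_zero_iff hβ).2 h0) hS b

/-- A row of the transform of large apparent distance forces many nonzero columns of `g`, and
consecutive zero rows of the transform are zeros of the transform of each column, so that each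
nonzero column has many nonzero entries. -/
theorem matSDRows_matDFT_le_card {α β : L} (hα : IsPrimitiveRoot α n)
    (hβ : IsPrimitiveRoot β r) {g : Matrix (ZMod n) (ZMod r) L}
    {T : Finset (ZMod n × ZMod r)} (hT : ∀ i j, (i, j) ∈ T ↔ g i j ≠ 0) :
    matSDRows (matDFT α β g) ≤ T.card := by
  classical
  set J : Finset (ZMod r) := T.image Prod.snd with hJ
  have hJ0 : ∀ j ∉ J, ∀ i, g i j = 0 := fun j hj i => by
    by_contra h0
    exact hj (Finset.mem_image.2 ⟨(i, j), (hT i j).2 h0, rfl⟩)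
  have hrow : ∀ a, (matDFT α β g).row a = vecDFT β (fun j => vecDFT α (fun i => g i j) a) :=
    fun a => funext fun b => matDFT_apply α β g a b
  have h1 : (Finset.univ.sup fun a => vecSD ((matDFT α β g).row a)) ≤ J.card := by
    refine Finset.sup_le fun a _ => ?_
    rw [hrow]
    refine vecSD_vecDFT_le_card hβ fun j hj => ?_
    simp [vecDFT, hJ0 j hj]
  have h2 : ∀ j ∈ J, (Finset.univ.sup fun a => zeroRun (matDFT α β g).row a) + 1 ≤
      (T.filter fun x => x.2 = j).card := by
    intro j hj
    obtain ⟨⟨i, j'⟩, hij, rfl⟩ := Finset.mem_image.1 hj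
    have hcol : (fun i => g i j') ≠ 0 := fun h0 => (hT i j').1 hij (congrFun h0 i)
    set S : Finset (ZMod n) := (T.filter fun x => x.2 = j').image Prod.fst with hSdef
    have hS : ∀ i ∉ S, g i j' = 0 := fun i hi => by
      by_contra h0
      exact hi (Finset.mem_image.2 ⟨(i, j'), by simp [hT, h0], rfl⟩)
    refine le_trans ?_ (Finset.card_image_le (f := Prod.fst))
    rw [← hSdef, Nat.succ_le_iff, Finset.sup_lt_iff
      ((Nat.zero_le _).trans_lt (zeroRun_vecDFT_lt_card hα hcol hS 0))]
    intro a _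
    refine lt_of_le_of_lt ?_ (zeroRun_vecDFT_lt_card hα hcol hS a)
    refine zeroRun_le_zeroRun (mt (vecDFT_eq_zero_iff hα).1 hcol) (fun a ha => ?_) a
    rw [hrow] at ha
    exact congrFun ((vecDFT_eq_zero_iff hβ).1 ha) j'
  calc matSDRows (matDFT α β g)
      ≤ J.card * ((Finset.univ.sup fun a => zeroRun (matDFT α β g).row a) + 1) :=
        Nat.mul_le_mul_right _ h1
    _ ≤ ∑ j ∈ J, (T.filter fun x => x.2 = j).card := by
        rw [← smul_eq_mul]
        exact Finset.card_nsmul_le_sum _ _ _ h2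
    _ = T.card := (Finset.card_eq_sum_card_image Prod.snd T).symm

/-- The multivariate BCH bound, for matrices `M` with the same zeros as a Fourier transform. -/
theorem matSD_le_card {A : Type*} [Zero A] {α β : L} (hα : IsPrimitiveRoot α n)
    (hβ : IsPrimitiveRoot β r) {g : Matrix (ZMod n) (ZMod r) L}
    {T : Finset (ZMod n × ZMod r)} (hT : ∀ i j, (i, j) ∈ T ↔ g i j ≠ 0)
    {M : Matrix (ZMod n) (ZMod r) A} (hM : ∀ a b, M a b = 0 ↔ matDFT α β g a b = 0) :
    matSD M ≤ T.card := by
  rw [matSD]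
  split_ifs
  · exact Nat.zero_le _
  refine max_le ?_ ?_
  · rw [matSDRows_congr hM]
    exact matSDRows_matDFT_le_card hα hβ hT
  · rw [matSDRows_congr (N := matDFT β α g.transpose) fun b a => by
      rw [← matDFT_transpose]; exact hM a b]
    rw [← T.card_map (Equiv.prodComm (ZMod n) (ZMod r)).toEmbedding]
    exact matSDRows_matDFT_le_card hβ hα fun j i => by simp [hT]

end Fourier

/-! ### Minimum distance as minimum weight -/

section Weight

variable {F G : Type*} [Field F] [AddCommMonoid G] [Fintype G]

theorem hammingDist_coeff_eq_card_support [DecidableEq F] (f g : AddMonoidAlgebra F G) :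
    hammingDist (⇑f.coeff) (⇑g.coeff) = (f - g).coeff.support.card := by
  rw [hammingDist]
  congr 1
  ext x
  simp [sub_eq_zero]

theorem minDist_le_card_support {C : Ideal (AddMonoidAlgebra F G)} {h : AddMonoidAlgebra F G}
    (hC : h ∈ C) (h0 : h ≠ 0) : minDist C ≤ h.coeff.support.card := by
  classical
  refine Nat.sInf_le ⟨h, hC, 0, C.zero_mem, h0, ?_⟩
  rw [hammingDist_coeff_eq_card_support, sub_zero]

theorem exists_minDist_eq_card_support {C : Ideal (AddMonoidAlgebra F G)} (hC : C ≠ ⊥) :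
    ∃ h ∈ C, h ≠ 0 ∧ minDist C = h.coeff.support.card := by
  classical
  obtain ⟨h, hh, h0⟩ := Submodule.exists_mem_ne_zero_of_ne_bot hC
  obtain ⟨f, hf, g, hg, hne, hd⟩ := Nat.sInf_mem (s := {d : ℕ | ∃ f ∈ C, ∃ g ∈ C, f ≠ g ∧
    d = hammingDist (⇑f.coeff) (⇑g.coeff)}) ⟨_, h, hh, 0, C.zero_mem, h0, rfl⟩
  refine ⟨f - g, C.sub_mem hf hg, sub_ne_zero.2 hne, ?_⟩
  rw [← hammingDist_coeff_eq_card_support]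
  exact hd

end Weight

/-! ### Evaluation at roots of unity as ring homomorphisms -/

section Evaluation

variable {F L : Type*} [Field F] [Field L] [Algebra F L] {n r : ℕ} [NeZero n] [NeZero r]

instance finite_addMonoidAlgebra {G : Type*} [Finite F] [Finite G] :
    Finite (AddMonoidAlgebra F G) :=
  Finite.of_injective (fun f : AddMonoidAlgebra F G => (⇑f.coeff : G → F))
    fun _ _ h => AddMonoidAlgebra.coeff_injective (DFunLike.coe_injective h)

/-- The character `j ↦ y ^ j` of `ZMod r` attached to an `r`-th root of unity `y`. -/
noncomputable def powHom (y : L) (hy : y ^ r = 1) : Multiplicative (ZMod r) →* L where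
  toFun j := y ^ (Multiplicative.toAdd j).val
  map_one' := by simp
  map_mul' i j := by
    rw [toAdd_mul, ZMod.val_add, ← pow_eq_pow_mod _ hy, pow_add]

theorem exists_ringHom_eval₁ {y : L} (hy : y ^ r = 1) :
    ∃ φ : CyclicAmbient F r →+* L, ∀ f, φ f = eval₁ f y := by
  refine ⟨(AddMonoidAlgebra.lift F L (ZMod r) (powHom y hy)).toRingHom, fun f => ?_⟩
  change AddMonoidAlgebra.lift F L (ZMod r) (powHom y hy) f = _
  rw [AddMonoidAlgebra.lift_apply', Finsupp.sum_fintype _ _ (by simp)]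
  rfl

theorem exists_ringHom_eval₂ {x y : L} (hx : x ^ n = 1) (hy : y ^ r = 1) :
    ∃ φ : BivariateAmbient F n r →+* L, ∀ f, φ f = eval₂ f x y := by
  refine ⟨(AddMonoidAlgebra.lift F L (ZMod n × ZMod r)
    { toFun := fun p => x ^ (Multiplicative.toAdd p).1.val * y ^ (Multiplicative.toAdd p).2.val
      map_one' := by simp
      map_mul' := fun p p' => ?_ }).toRingHom, fun f => ?_⟩
  · rw [toAdd_mul, Prod.fst_add, Prod.snd_add, ZMod.val_add, ZMod.val_add,
      ← pow_eq_pow_mod _ hx, ← pow_eq_pow_mod _ hy, pow_add, pow_add, mul_mul_mul_comm]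
  · change AddMonoidAlgebra.lift F L (ZMod n × ZMod r) _ f = _
    rw [AddMonoidAlgebra.lift_apply', Finsupp.sum_fintype _ _ (by simp), Fintype.sum_prod_type]
    rfl

theorem pow_val_pow_eq_one {k : ℕ} {β : L} (hβ : IsPrimitiveRoot β k) (b : ZMod k) :
    (β ^ b.val) ^ k = 1 := by
  rw [← pow_mul, mul_comm, pow_mul, hβ.pow_eq_one, one_pow]

/-- The homomorphism `f ↦ f(β ^ b)`. -/
noncomputable def evalHom₁ {β : L} (hβ : IsPrimitiveRoot β r) (b : ZMod r) : CyclicAmbient F r →+* L :=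
  (exists_ringHom_eval₁ (pow_val_pow_eq_one hβ b)).choose

theorem evalHom₁_apply {β : L} (hβ : IsPrimitiveRoot β r) (b : ZMod r) (f : CyclicAmbient F r) :
    evalHom₁ hβ b f = eval₁ f (β ^ b.val) :=
  (exists_ringHom_eval₁ (pow_val_pow_eq_one hβ b)).choose_spec f

/-- The homomorphism `f ↦ f(α ^ a, β ^ b)`. -/
noncomputable def evalHom₂ {α β : L} (hα : IsPrimitiveRoot α n) (hβ : IsPrimitiveRoot β r)
    (p : ZMod n × ZMod r) : BivariateAmbient F n r →+* L :=
  (exists_ringHom_eval₂ (pow_val_pow_eq_one hα p.1) (pow_val_pow_eq_one hβ p.2)).choose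

theorem evalHom₂_apply {α β : L} (hα : IsPrimitiveRoot α n) (hβ : IsPrimitiveRoot β r)
    (p : ZMod n × ZMod r) (f : BivariateAmbient F n r) :
    evalHom₂ hα hβ p f = eval₂ f (α ^ p.1.val) (β ^ p.2.val) :=
  (exists_ringHom_eval₂ (pow_val_pow_eq_one hα p.1) (pow_val_pow_eq_one hβ p.2)).choose_spec f

theorem dft₁_eq_vecDFT (β : L) (f : CyclicAmbient F r) :
    dft₁ β f = vecDFT β fun j => algebraMap F L (f.coeff j) := rfl

theorem dft₂_eq_matDFT (α β : L) (f : BivariateAmbient F n r) :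
    dft₂ α β f = matDFT α β (Matrix.of fun i j => algebraMap F L (f.coeff (i, j))) := rfl

theorem dft₁_eq_zero_iff {β : L} (hβ : IsPrimitiveRoot β r) {f : CyclicAmbient F r} :
    dft₁ β f = 0 ↔ f = 0 := by
  rw [dft₁_eq_vecDFT, vecDFT_eq_zero_iff hβ]
  refine ⟨fun h => AddMonoidAlgebra.ext (Finsupp.ext fun j => ?_), fun h => ?_⟩
  · simpa using congrFun h j
  · funext j; simp [h]

theorem dft₂_eq_zero_iff {α β : L} (hα : IsPrimitiveRoot α n) (hβ : IsPrimitiveRoot β r)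
    {f : BivariateAmbient F n r} : dft₂ α β f = 0 ↔ f = 0 := by
  rw [dft₂_eq_matDFT, matDFT_eq_zero_iff hα hβ]
  refine ⟨fun h => AddMonoidAlgebra.ext (Finsupp.ext fun p => ?_), fun h => ?_⟩
  · simpa using congrFun (congrFun h p.1) p.2
  · funext i j; simp [h]

theorem evalHom₁_separates {β : L} (hβ : IsPrimitiveRoot β r) (f : CyclicAmbient F r)
    (h : ∀ b, evalHom₁ hβ b f = 0) : f = 0 :=
  (dft₁_eq_zero_iff hβ).1 (funext fun b => (evalHom₁_apply hβ b f).symm.trans (h b))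

theorem evalHom₂_separates {α β : L} (hα : IsPrimitiveRoot α n) (hβ : IsPrimitiveRoot β r)
    (f : BivariateAmbient F n r) (h : ∀ p, evalHom₂ hα hβ p f = 0) : f = 0 :=
  (dft₂_eq_zero_iff hα hβ).1 <| Matrix.ext fun a b =>
    (evalHom₂_apply hα hβ (a, b) f).symm.trans (h (a, b))

theorem mem_iff_definingSet₁ [Finite F] {β : L} (hβ : IsPrimitiveRoot β r)
    (C : Ideal (CyclicAmbient F r)) (f : CyclicAmbient F r) :
    f ∈ C ↔ ∀ b ∈ definingSet₁ β C, dft₁ β f b = 0 := by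
  rw [mem_ideal_iff_forall_map_eq_zero (evalHom₁ hβ) (evalHom₁_separates hβ)]
  simp only [evalHom₁_apply]
  rfl

theorem mem_iff_definingSet₂ [Finite F] {α β : L} (hα : IsPrimitiveRoot α n)
    (hβ : IsPrimitiveRoot β r) (E : Ideal (BivariateAmbient F n r)) (f : BivariateAmbient F n r) :
    f ∈ E ↔ ∀ p ∈ definingSet₂ α β E, dft₂ α β f p.1 p.2 = 0 := by
  rw [mem_ideal_iff_forall_map_eq_zero (evalHom₂ hα hβ) (evalHom₂_separates hα hβ)]
  simp only [evalHom₂_apply]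
  rfl

/-- The strong apparent distance, for any choice of roots of unity, is a lower bound for the
minimum distance: a word of minimum weight has an idempotent power, whose transform has the same
zeros. -/
theorem sdAt₂_le_minDist [Finite F] {α β : L} (hα : IsPrimitiveRoot α n)
    (hβ : IsPrimitiveRoot β r) {E : Ideal (BivariateAmbient F n r)} (hE : E ≠ ⊥) :
    sdAt₂ α β E ≤ minDist E := by
  obtain ⟨h, hh, h0, hd⟩ := exists_minDist_eq_card_support hE
  obtain ⟨k, hk, hid⟩ := exists_pow_isIdempotentElem h
  have hzero : ∀ a b, dft₂ α β (h ^ k) a b = 0 ↔ dft₂ α β h a b = 0 := fun a b => by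
    change eval₂ (h ^ k) (α ^ a.val) (β ^ b.val) = 0 ↔ eval₂ h (α ^ a.val) (β ^ b.val) = 0
    rw [← evalHom₂_apply hα hβ (a, b), ← evalHom₂_apply hα hβ (a, b), map_pow,
      pow_eq_zero_iff hk]
  have hne : h ^ k ≠ 0 := fun h1 => h0 <| (dft₂_eq_zero_iff hα hβ).1 <| Matrix.ext fun a b =>
    (hzero a b).1 (by rw [(dft₂_eq_zero_iff hα hβ).2 h1]; rfl)
  rw [hd]
  refine (Nat.sInf_le ⟨h ^ k, E.pow_mem_of_mem hh k (Nat.pos_of_ne_zero hk), hne,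
    (sq _).trans hid, rfl⟩ : sdAt₂ α β E ≤ matSD (dft₂ α β (h ^ k))).trans ?_
  exact matSD_le_card hα hβ (g := Matrix.of fun i j => algebraMap F L (h.coeff (i, j)))
    (fun i j => by simp) hzero

end Evaluation

/-! ### The code `C_n`, whose rows are the words of `C` -/

section Extension

variable {F L : Type*} [Field F] [Field L] [Algebra F L] {n r : ℕ} [NeZero n] [NeZero r]

/-- The word given by the `i`-th row of a bivariate word. -/
noncomputable def rowWord {n : ℕ} (f : BivariateAmbient F n r) (i : ZMod n) : CyclicAmbient F r :=
  AddMonoidAlgebra.ofCoeff (Finsupp.equivFunOnFinite.symm fun j => f.coeff (i, j))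

/-- The bivariate word with a given word as its row of index `0`, and zero rows elsewhere. -/
noncomputable def firstRow (n : ℕ) [NeZero n] (c : CyclicAmbient F r) : BivariateAmbient F n r :=
  AddMonoidAlgebra.ofCoeff (Finsupp.equivFunOnFinite.symm fun p : ZMod n × ZMod r =>
    if p.1 = 0 then c.coeff p.2 else 0)

@[simp]
theorem rowWord_coeff {n : ℕ} (f : BivariateAmbient F n r) (i : ZMod n) (j : ZMod r) :
    (rowWord f i).coeff j = f.coeff (i, j) := rfl

@[simp]
theorem firstRow_coeff (c : CyclicAmbient F r) (i : ZMod n) (j : ZMod r) :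
    (firstRow n c).coeff (i, j) = if i = 0 then c.coeff j else 0 := rfl

theorem dft₂_firstRow (α β : L) (c : CyclicAmbient F r) (a : ZMod n) (b : ZMod r) :
    dft₂ α β (firstRow n c) a b = dft₁ β c b := by
  rw [dft₂_eq_matDFT, dft₁_eq_vecDFT, matDFT_apply]
  congr 1
  funext j
  rw [vecDFT, Finset.sum_eq_single 0]
  · simp
  · intro i _ hi
    simp [hi]
  · simp

theorem dft₂_apply_eq_vecDFT (α β : L) (f : BivariateAmbient F n r) (a : ZMod n) (b : ZMod r) :
    dft₂ α β f a b = vecDFT α (fun i => dft₁ β (rowWord f i) b) a := by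
  rw [← Matrix.transpose_apply (dft₂ α β f), dft₂_eq_matDFT, matDFT_transpose, matDFT_apply]
  rfl

theorem firstRow_ne_zero {c : CyclicAmbient F r} (hc : c ≠ 0) : firstRow n c ≠ 0 := by
  contrapose! hc
  refine AddMonoidAlgebra.ext (Finsupp.ext fun j => ?_)
  have := firstRow_coeff (n := n) c 0 j
  rw [hc] at this
  simpa using this.symm

theorem card_support_firstRow (c : CyclicAmbient F r) :
    (firstRow n c).coeff.support.card = c.coeff.support.card := by
  rw [← Finset.card_map (Function.Embedding.sectR (0 : ZMod n) (ZMod r))]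
  congr 1
  ext ⟨i, j⟩
  by_cases hi : i = 0 <;> simp [hi, eq_comm]

theorem card_support_rowWord_le {n : ℕ} (f : BivariateAmbient F n r) (i : ZMod n) :
    (rowWord f i).coeff.support.card ≤ f.coeff.support.card := by
  rw [← Finset.card_map (Function.Embedding.sectR i (ZMod r))]
  refine Finset.card_le_card fun p hp => ?_
  obtain ⟨j, hj, rfl⟩ := Finset.mem_map.1 hp
  simpa using hj

/-- An abelian code with defining set `ZMod n × D`, where `D` is the defining set of `C`, consists
of the words with all rows in `C`. -/
theorem mem_iff_rowWord_mem [Finite F] {α β : L} (hα : IsPrimitiveRoot α n)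
    (hβ : IsPrimitiveRoot β r) {C : Ideal (CyclicAmbient F r)}
    {E : Ideal (BivariateAmbient F n r)}
    (hE : definingSet₂ α β E = (Set.univ : Set (ZMod n)) ×ˢ definingSet₁ β C)
    (f : BivariateAmbient F n r) : f ∈ E ↔ ∀ i, rowWord f i ∈ C := by
  rw [mem_iff_definingSet₂ hα hβ, hE]
  simp only [mem_iff_definingSet₁ hβ, dft₂_apply_eq_vecDFT]
  constructor
  · intro h i b hb
    refine congrFun ((vecDFT_eq_zero_iff (v := fun i => dft₁ β (rowWord f i) b) hα).1
      (funext fun a => ?_)) i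
    exact h (a, b) ⟨Set.mem_univ _, hb⟩
  · rintro h ⟨a, b⟩ ⟨-, hb⟩
    rw [(vecDFT_eq_zero_iff hα).2 (funext fun i => h i b hb)]
    rfl

/-- The words whose transform vanishes on `ZMod n × D`, where `D` is the defining set of `C`,
form an ideal. Conversely, words of `C` placed in one row show that its defining set is no
larger. -/
theorem exists_definingSet₂_eq {α β : L} (hα : IsPrimitiveRoot α n)
    (hβ : IsPrimitiveRoot β r) (C : Ideal (CyclicAmbient F r)) :
    ∃ E : Ideal (BivariateAmbient F n r),
      definingSet₂ α β E = (Set.univ : Set (ZMod n)) ×ˢ definingSet₁ β C := by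
  refine ⟨⨅ p ∈ (Set.univ : Set (ZMod n)) ×ˢ definingSet₁ β C,
    RingHom.ker (evalHom₂ (F := F) hα hβ p), Set.Subset.antisymm ?_ ?_⟩
  · rintro ⟨a, b⟩ hab
    refine ⟨Set.mem_univ _, fun c hc => ?_⟩
    have hmem : firstRow n c ∈ ⨅ p ∈ (Set.univ : Set (ZMod n)) ×ˢ definingSet₁ β C,
        RingHom.ker (evalHom₂ (F := F) hα hβ p) := by
      simp only [Submodule.mem_iInf, RingHom.mem_ker, evalHom₂_apply]
      rintro ⟨a', b'⟩ ⟨-, hb'⟩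
      exact (dft₂_firstRow α β c a' b').trans (hb' c hc)
    exact (dft₂_firstRow α β c a b).symm.trans (hab _ hmem)
  · intro p hp c hc
    rw [← evalHom₂_apply hα hβ]
    simp only [Submodule.mem_iInf] at hc
    exact hc p hp

theorem firstRow_mem [Finite F] {α β : L} (hα : IsPrimitiveRoot α n)
    (hβ : IsPrimitiveRoot β r) {C : Ideal (CyclicAmbient F r)}
    {E : Ideal (BivariateAmbient F n r)}
    (hE : definingSet₂ α β E = (Set.univ : Set (ZMod n)) ×ˢ definingSet₁ β C)
    {c : CyclicAmbient F r} (hc : c ∈ C) : firstRow n c ∈ E := by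
  rw [mem_iff_definingSet₂ hα hβ, hE]
  rintro ⟨a, b⟩ ⟨-, hb⟩
  exact (dft₂_firstRow α β c a b).trans (hb c hc)

theorem ne_bot_of_definingSet₂_eq [Finite F] {α β : L} (hα : IsPrimitiveRoot α n)
    (hβ : IsPrimitiveRoot β r) {C : Ideal (CyclicAmbient F r)} (hC : C ≠ ⊥)
    {E : Ideal (BivariateAmbient F n r)}
    (hE : definingSet₂ α β E = (Set.univ : Set (ZMod n)) ×ˢ definingSet₁ β C) : E ≠ ⊥ := by
  obtain ⟨c, hc, h0⟩ := Submodule.exists_mem_ne_zero_of_ne_bot hC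
  exact (Submodule.ne_bot_iff _).2 ⟨_, firstRow_mem hα hβ hE hc, firstRow_ne_zero h0⟩

theorem minDist_eq_of_definingSet₂_eq [Finite F] {α β : L} (hα : IsPrimitiveRoot α n)
    (hβ : IsPrimitiveRoot β r) {C : Ideal (CyclicAmbient F r)} (hC : C ≠ ⊥)
    {E : Ideal (BivariateAmbient F n r)}
    (hE : definingSet₂ α β E = (Set.univ : Set (ZMod n)) ×ˢ definingSet₁ β C) :
    minDist E = minDist C := by
  apply le_antisymm
  · obtain ⟨c, hc, h0, hd⟩ := exists_minDist_eq_card_support hC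
    rw [hd, ← card_support_firstRow (n := n)]
    exact minDist_le_card_support (firstRow_mem hα hβ hE hc) (firstRow_ne_zero h0)
  · obtain ⟨f, hf, h0, hd⟩ := exists_minDist_eq_card_support (ne_bot_of_definingSet₂_eq hα hβ hC hE)
    obtain ⟨i, hi⟩ : ∃ i, rowWord f i ≠ 0 := by
      contrapose! h0
      refine AddMonoidAlgebra.ext (Finsupp.ext fun p => ?_)
      rw [← rowWord_coeff f p.1 p.2, h0]
      rfl
    rw [hd]
    exact (minDist_le_card_support ((mem_iff_rowWord_mem hα hβ hE f).1 hf i) hi).trans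
      (card_support_rowWord_le f i)

/-- The generating idempotent of `C` has the largest support among the transforms of words of `C`,
so it has the least apparent distance, and it is compared with each row of the transform of an
idempotent of `E`. Such a row need not be the transform of a word over `F`. -/
theorem sdAt₁_le_sdAt₂ [Finite F] {α β : L} (hα : IsPrimitiveRoot α n)
    (hβ : IsPrimitiveRoot β r) {C : Ideal (CyclicAmbient F r)} (hC : C ≠ ⊥)
    {E : Ideal (BivariateAmbient F n r)}
    (hE : definingSet₂ α β E = (Set.univ : Set (ZMod n)) ×ˢ definingSet₁ β C) :
    sdAt₁ β C ≤ sdAt₂ α β E := by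
  obtain ⟨e, he, hee, hez⟩ :=
    exists_idempotent_map_eq_zero_iff (evalHom₁ hβ) (evalHom₁_separates hβ) C
  simp only [evalHom₁_apply] at hez
  have he0 : e ≠ 0 := by
    rintro rfl
    obtain ⟨c, hc, h0⟩ := Submodule.exists_mem_ne_zero_of_ne_bot hC
    refine h0 ((dft₁_eq_zero_iff hβ).1 (funext fun b => (hez b).1 ?_ c hc))
    exact congrFun ((dft₁_eq_zero_iff (F := F) hβ).2 rfl) b
  obtain ⟨f, hf, hf0⟩ :=
    Submodule.exists_mem_ne_zero_of_ne_bot (ne_bot_of_definingSet₂_eq hα hβ hC hE)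
  obtain ⟨g, hg, hgg, hgz⟩ :=
    exists_idempotent_map_eq_zero_iff (evalHom₂ hα hβ) (evalHom₂_separates hα hβ) E
  have hg0 : g ≠ 0 := by
    rintro rfl
    exact hf0 (evalHom₂_separates hα hβ f fun p => (hgz p).1 (map_zero _) f hf)
  refine le_csInf ⟨_, g, hg, hg0, hgg, rfl⟩ ?_
  rintro d ⟨u, hu, hu0, -, rfl⟩
  obtain ⟨a, ha⟩ : ∃ a, (dft₂ α β u).row a ≠ 0 := by
    contrapose! hu0
    exact (dft₂_eq_zero_iff hα hβ).1 (Matrix.ext fun a b => congrFun (hu0 a) b)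
  refine (Nat.sInf_le ⟨e, he, he0, hee, rfl⟩ : sdAt₁ β C ≤ _).trans
    (le_trans (vecSD_le_vecSD ha fun b hb => ?_) (vecSD_row_le_matSD _ a))
  exact (mem_iff_definingSet₂ hα hβ E u).1 hu (a, b) (by
    rw [hE]; exact ⟨Set.mem_univ _, (hez b).1 hb⟩)

end Extension

end AbelianCode

theorem mainTheorem3 {F L : Type*} [Field F] [Finite F] [Field L] [Algebra F L]
    (q n r : ℕ) [NeZero n] [NeZero r]
    (hq : Nat.card F = q) (hcop : Nat.gcd q (n * r) = 1)
    (hUn : (primitiveRoots n L).Nonempty) (hUr : (primitiveRoots r L).Nonempty)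
    (C : Ideal (AbelianCode.CyclicAmbient F r)) (hC : C ≠ ⊥)
    (hsd : AbelianCode.sd₁ L C = AbelianCode.minDist C) :
    ∃ α₁ ∈ primitiveRoots n L, ∃ α₂ ∈ AbelianCode.optimizedRoots L C,
      (∃! Cn : Ideal (AbelianCode.BivariateAmbient F n r),
        AbelianCode.definingSet₂ α₁ α₂ Cn
          = (Set.univ : Set (ZMod n)) ×ˢ AbelianCode.definingSet₁ α₂ C) ∧
      ∀ Cn : Ideal (AbelianCode.BivariateAmbient F n r),
        AbelianCode.definingSet₂ α₁ α₂ Cn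
          = (Set.univ : Set (ZMod n)) ×ˢ AbelianCode.definingSet₁ α₂ C →
        AbelianCode.minDist Cn = AbelianCode.minDist C ∧
        AbelianCode.sd₂ L Cn = AbelianCode.minDist Cn := by
  have hprim₁ : ∀ α ∈ primitiveRoots n L, IsPrimitiveRoot α n := fun α hα =>
    (mem_primitiveRoots (Nat.pos_of_ne_zero (NeZero.ne n))).1 hα
  have hprim₂ : ∀ β ∈ primitiveRoots r L, IsPrimitiveRoot β r := fun β hβ =>
    (mem_primitiveRoots (Nat.pos_of_ne_zero (NeZero.ne r))).1 hβ
  obtain ⟨α, hα⟩ := hUn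
  obtain ⟨β, hβ, hmax⟩ :=
    Finset.exists_mem_eq_sup _ hUr fun β : L => AbelianCode.sdAt₁ β C
  have hα' := hprim₁ α hα
  have hβ' := hprim₂ β hβ
  refine ⟨α, hα, β, ⟨hβ, hmax⟩, ?_, fun E hE => ?_⟩
  · obtain ⟨E, hE⟩ := AbelianCode.exists_definingSet₂_eq (F := F) hα' hβ' C
    refine ⟨E, hE, fun E' hE' => Ideal.ext fun f => ?_⟩
    rw [AbelianCode.mem_iff_definingSet₂ hα' hβ', AbelianCode.mem_iff_definingSet₂ hα' hβ',
      hE, hE']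
  · have hd := AbelianCode.minDist_eq_of_definingSet₂_eq hα' hβ' hC hE
    refine ⟨hd, le_antisymm (Finset.sup_le fun p hp => ?_) ?_⟩
    · obtain ⟨h1, h2⟩ := Finset.mem_product.1 hp
      exact AbelianCode.sdAt₂_le_minDist (hprim₁ _ h1) (hprim₂ _ h2)
        (AbelianCode.ne_bot_of_definingSet₂_eq hα' hβ' hC hE)
    · rw [hd, ← hsd, AbelianCode.sd₁, hmax]
      refine le_trans (AbelianCode.sdAt₁_le_sdAt₂ hα' hβ' hC hE) ?_
      rw [AbelianCode.sd₂]
      exact Finset.le_sup (f := fun p : L × L => AbelianCode.sdAt₂ p.1 p.2 E) (b := (α, β))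
        (Finset.mk_mem_product hα hβ)
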